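/- A signature of multi-modal first-order modal logic ($MMFOL$) is a pair $(\Lambda,(F,P))$, where $\Lambda=(\Lambda_n)_{n\in\omega}$ is a family of sets of modality symbols and $F=(F_n)_{n\in\omega}$, $P=(P_n)_{n\in\omega}$ are families of sets of function and of predicate symbols ($n$ is the arity); signature morphisms are families of functions, so $\mathrm{Sign}^{MMFOL}=\mathbf{Set}^\omega\times(\mathbf{Set}^\omega\times\mathbf{Set}^\omega)$. A $(\Lambda,(F,P))$-model $(W,M)$ consists of a set $|W|$ of worlds with a relation $W_\lambda\subseteq|W|^n$ for each $\lambda\in\Lambda_n$, and of a first-order $(F,P)$-model $M^w$ for each $w\in|W|$, such that $|M^w|=|M^v|$ and $M^w_c=M^v_c$ for all $w,v\in|W|$ and $c\in F_0$. A homomorphism $(W,M)\to(V,N)$ consists of a function $h_0:|W|\to|V|$ which preserves the relations, and of first-order homomorphisms $h^w:M^w\to N^{h_0(w)}$, $w\in|W|$, which are all the same function. Sentences are built from the atoms $\pi(t_1,\dots,t_n)$ (no equality) by $\wedge$, $\neg$, $(\exists x)$, and $\langle\lambda\rangle(\rho_1,\dots,\rho_n)$ for $\lambda\in\Lambda_{n+1}$,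 where $\langle\lambda\rangle(\rho_1,\dots,\rho_n)$ holds at $w$ iff there is $(w,w_1,\dots,w_n)\in W_\lambda$ such that $\rho_i$ holds at $w_i$ for all $i$; variables take values in the shared carrier. Reducts interpret each symbol as its translation and keep worlds and carriers. With $[\![(W,M)]\!]=|W|$ this is a (strict) stratified institution. Let $FOL$ be single-sorted first-order logic without equality. Let $REL$ be its fragment without function symbols, regarded as a stratified institution without sentences in which $[\![W]\!]=|W|$. Let $\widetilde{FOL}^C$ be the stratified institution with the signatures and sentences of $FOL$, whose models are the families $(M^w)_{w\in W}$ of first-order models, indexed by a set $W$, with shared carriers and constants as above, whose homomorphisms are the pairs $(h_0,(h^w)_{w\in W})$ as above (without relations on $W$), with $[\![(W,M)]\!]=W$ and $(W,M)\models^w\rho$ iff $M^w\models\rho$. Then: 1. The projections $REL\leftarrow MMFOL\rightarrow\widetilde{FOL}^C$, given by $(\Lambda,(F,P))\mapsto\Lambda$, $(W,M)\mapsto(|W|,(W_\lambda)_\lambda)$ and by $(\Lambda,(F,P))\mapsto(F,P)$, $(W,M)\mapsto(|W|,M)$ (with the inclusion of the $FOL$ sentences), are a decomposition of $MMFOL$: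 for each signature $(\Lambda,(F,P))$ they make $\mathrm{Mod}^{MMFOL}(\Lambda,(F,P))$ the pullback of $\mathrm{Mod}^{REL}(\Lambda)\xrightarrow{[\![\_]\!]}\mathbf{Set}\xleftarrow{[\![\_]\!]}\mathrm{Mod}^{\widetilde{FOL}^C}(F,P)$ in $\mathbf{CAT}$. 2. $MMFOL$ is semi-exact: for each pushout square of $MMFOL$ signature morphisms $\varphi_1:\Sigma\to\Sigma_1$, $\varphi_2:\Sigma\to\Sigma_2$, $\theta_1:\Sigma_1\to\Sigma'$, $\theta_2:\Sigma_2\to\Sigma'$, and for all $\Sigma_k$-models $M_k$ ($k=1,2$) with $\mathrm{Mod}(\varphi_1)(M_1)=\mathrm{Mod}(\varphi_2)(M_2)$, there is a unique $\Sigma'$-model $M'$ with $\mathrm{Mod}(\theta_1)(M')=M_1$ and $\mathrm{Mod}(\theta_2)(M')=M_2$. -/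

import Mathlib

open CategoryTheory Opposite

universe u

namespace StratInst

/-! ### Institutions and stratified institutions -/

/-- An institution: signatures, sentences, models with their reducts, and a satisfaction
relation such that truth is invariant under change of notation. -/
structure Institution where
  Sign : Type (u + 1)
  [category : Category.{u} Sign]
  Sen : Sign ⥤ Type u
  Mod : Signᵒᵖ ⥤ Cat.{u, u + 1}
  Sat : ∀ S : Sign, Mod.obj (op S) → Sen.obj S → Prop
  sat_condition : ∀ {S T : Sign} (φ : S ⟶ T) (M : Mod.obj (op T)) (ρ : Sen.obj S),
    Sat T M (Sen.map φ ρ) ↔ Sat S ((Mod.map φ.op).toFunctor.obj M) ρ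

attribute [instance] Institution.category

/-- A stratified institution. The stratification is a lax natural transformation from the model
functor to the functor constantly equal to the category of sets: `strat S` is its component at
`S`, `stratMap φ` its component at `φ`. The two coherence laws relate sets which are equal only
because `Mod` is a functor, whence the heterogeneous equalities. -/
structure StratifiedInstitution where
  Sign : Type (u + 1)
  [category : Category.{u} Sign]
  Sen : Sign ⥤ Type u
  Mod : Signᵒᵖ ⥤ Cat.{u, u + 1}
  strat : ∀ S : Sign, Mod.obj (op S) ⥤ Type u
  stratMap : ∀ {S T : Sign} (φ : S ⟶ T), strat T ⟶ (Mod.map φ.op).toFunctor ⋙ strat S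
  stratMap_id : ∀ (S : Sign) (M : Mod.obj (op S)) (w : (strat S).obj M),
    HEq ((stratMap (𝟙 S)).app M w) w
  stratMap_comp : ∀ {S T U : Sign} (φ : S ⟶ T) (ψ : T ⟶ U) (M : Mod.obj (op U))
    (w : (strat U).obj M),
    HEq ((stratMap (φ ≫ ψ)).app M w)
      ((stratMap φ).app ((Mod.map ψ.op).toFunctor.obj M) ((stratMap ψ).app M w))
  Sat : ∀ (S : Sign) (M : Mod.obj (op S)), (strat S).obj M → Sen.obj S → Prop
  sat_condition : ∀ {S T : Sign} (φ : S ⟶ T) (M : Mod.obj (op T)) (w : (strat T).obj M)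
    (ρ : Sen.obj S),
    Sat S ((Mod.map φ.op).toFunctor.obj M) ((stratMap φ).app M w) ρ ↔ Sat T M w (Sen.map φ ρ)

attribute [instance] StratifiedInstitution.category

namespace StratifiedInstitution

/-- The reduct of a `T`-model along the signature morphism `φ : S ⟶ T`. -/
abbrev reduct (I : StratifiedInstitution.{u}) {S T : I.Sign} (φ : S ⟶ T)
    (M : I.Mod.obj (op T)) : I.Mod.obj (op S) :=
  (I.Mod.map φ.op).toFunctor.obj M

/-- A square of signature morphisms (commutative in all uses) is a model amalgamation square if
any two models with the same reduct to the common source are the reducts of a unique model. -/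
def IsModelAmalgamationSquare (I : StratifiedInstitution.{u}) {S S₁ S₂ T : I.Sign}
    (φ₁ : S ⟶ S₁) (φ₂ : S ⟶ S₂) (θ₁ : S₁ ⟶ T) (θ₂ : S₂ ⟶ T) : Prop :=
  ∀ (M₁ : I.Mod.obj (op S₁)) (M₂ : I.Mod.obj (op S₂)), I.reduct φ₁ M₁ = I.reduct φ₂ M₂ →
    ∃! M : I.Mod.obj (op T), I.reduct θ₁ M = M₁ ∧ I.reduct θ₂ M = M₂

/-- All pushout squares of signature morphisms are model amalgamation squares. -/
def IsSemiExact (I : StratifiedInstitution.{u}) : Prop :=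
  ∀ {S S₁ S₂ T : I.Sign} (φ₁ : S ⟶ S₁) (φ₂ : S ⟶ S₂) (θ₁ : S₁ ⟶ T) (θ₂ : S₂ ⟶ T),
    IsPushout φ₁ φ₂ θ₁ θ₂ → I.IsModelAmalgamationSquare φ₁ φ₂ θ₁ θ₂

end StratifiedInstitution

/-- A strict morphism of stratified institutions `I ⟶ J`: the model component `β` is natural on
the nose, and it is compatible with the stratifications and with satisfaction. -/
structure StrictMorphism (I J : StratifiedInstitution.{u}) where
  Φ : I.Sign ⥤ J.Sign
  α : Φ ⋙ J.Sen ⟶ I.Sen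
  β : I.Mod ⟶ Φ.op ⋙ J.Mod
  strat_eq : ∀ S : I.Sign,
    (β.app (op S)).toFunctor ⋙ J.strat (Φ.obj S) = I.strat S
  stratMap_eq : ∀ {S T : I.Sign} (φ : S ⟶ T) (M : I.Mod.obj (op T))
    (v : (J.strat (Φ.obj T)).obj ((β.app (op T)).toFunctor.obj M)) (w : (I.strat T).obj M),
    HEq v w →
      HEq ((J.stratMap (Φ.map φ)).app ((β.app (op T)).toFunctor.obj M) v)
        ((I.stratMap φ).app M w)
  sat_condition : ∀ (S : I.Sign) (M : I.Mod.obj (op S))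
    (v : (J.strat (Φ.obj S)).obj ((β.app (op S)).toFunctor.obj M)) (w : (I.strat S).obj M)
    (ρ : J.Sen.obj (Φ.obj S)), HEq v w →
      (I.Sat S M w (α.app S ρ) ↔ J.Sat (Φ.obj S) ((β.app (op S)).toFunctor.obj M) v ρ)

/-! ### The stratified institution of families of models of an institution -/

section Families

/-- A set of worlds with a family of objects of the category `C` indexed by it. -/
structure Family (C : Type (u + 1)) where
  World : Type u
  model : World → C

/-- A map of worlds together with a morphism of `C` for each world. -/
@[ext]
structure FamilyHom {C : Type (u + 1)} [Category.{u} C] (M N : Family C) where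
  onWorld : M.World → N.World
  hom : ∀ w, M.model w ⟶ N.model (onWorld w)

instance (C : Type (u + 1)) [Category.{u} C] : Category.{u} (Family C) where
  Hom M N := FamilyHom M N
  id M := ⟨id, fun w => 𝟙 (M.model w)⟩
  comp f g := ⟨g.onWorld ∘ f.onWorld, fun w => f.hom w ≫ g.hom (f.onWorld w)⟩
  id_comp f := FamilyHom.ext rfl (heq_of_eq (funext fun w => Category.id_comp (f.hom w)))
  comp_id f := FamilyHom.ext rfl (heq_of_eq (funext fun w => Category.comp_id (f.hom w)))
  assoc f g h := FamilyHom.ext rfl (heq_of_eq (funext fun w =>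
    Category.assoc (f.hom w) (g.hom (f.onWorld w)) (h.hom (g.onWorld (f.onWorld w)))))

/-- The action of a functor on families, world by world. -/
def Family.map {C D : Type (u + 1)} [Category.{u} C] [Category.{u} D] (G : C ⥤ D) :
    Family C ⥤ Family D where
  obj M := ⟨M.World, fun w => G.obj (M.model w)⟩
  map f := ⟨f.onWorld, fun w => G.map (f.hom w)⟩
  map_id M := FamilyHom.ext rfl (heq_of_eq (funext fun w => G.map_id (M.model w)))
  map_comp f g := FamilyHom.ext rfl (heq_of_eq (funext fun w =>
    G.map_comp (f.hom w) (g.hom (f.onWorld w))))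

variable (B : Institution.{u})

/-- The families of `S`-models of the institution `B`. -/
abbrev ModelFamily (S : B.Sign) : Type (u + 1) := Family (B.Mod.obj (op S))

/-- The reduct of families of models along a signature morphism. -/
abbrev ModelFamily.reduct {S T : B.Sign} (φ : S ⟶ T) : ModelFamily B T ⥤ ModelFamily B S :=
  Family.map (B.Mod.map φ.op).toFunctor

/-- A constraint on families of models of `B`: a sub-functor of the functor which assigns to each
signature the category of families of models. -/
structure ConstraintSubfunctor where
  obj : ∀ {S : B.Sign}, ModelFamily B S → Prop
  hom : ∀ {S : B.Sign} {M N : ModelFamily B S}, (M ⟶ N) → Prop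
  id_mem : ∀ {S : B.Sign} (M : ModelFamily B S), obj M → hom (𝟙 M)
  comp_mem : ∀ {S : B.Sign} {M N P : ModelFamily B S} (f : M ⟶ N) (g : N ⟶ P),
    obj M → obj N → obj P → hom f → hom g → hom (f ≫ g)
  reduct_obj : ∀ {S T : B.Sign} (φ : S ⟶ T) (M : ModelFamily B T),
    obj M → obj ((ModelFamily.reduct B φ).obj M)
  reduct_hom : ∀ {S T : B.Sign} (φ : S ⟶ T) {M N : ModelFamily B T} (f : M ⟶ N),
    obj M → obj N → hom f → hom ((ModelFamily.reduct B φ).map f)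

variable {B}

/-- The families of models which satisfy the constraint. -/
structure ConstrainedFamily (C : ConstraintSubfunctor B) (S : B.Sign) where
  family : ModelFamily B S
  property : C.obj family

/-- The homomorphisms of families which satisfy the constraint. -/
@[ext]
structure ConstrainedHom {C : ConstraintSubfunctor B} {S : B.Sign}
    (M N : ConstrainedFamily C S) where
  hom : M.family ⟶ N.family
  property : C.hom hom

instance (C : ConstraintSubfunctor B) (S : B.Sign) :
    Category.{u} (ConstrainedFamily C S) where
  Hom M N := ConstrainedHom M N
  id M := ⟨𝟙 M.family, C.id_mem _ M.property⟩
  comp {M N P} f g :=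
    ⟨f.hom ≫ g.hom, C.comp_mem _ _ M.property N.property P.property f.property g.property⟩
  id_comp f := ConstrainedHom.ext (Category.id_comp f.hom)
  comp_id f := ConstrainedHom.ext (Category.comp_id f.hom)
  assoc f g h := ConstrainedHom.ext (Category.assoc f.hom g.hom h.hom)

/-- A functor between categories of models which preserves the constraint acts on the
constrained families. -/
def ConstrainedFamily.map (C : ConstraintSubfunctor B) {S T : B.Sign}
    (G : B.Mod.obj (op T) ⥤ B.Mod.obj (op S))
    (ho : ∀ M : ModelFamily B T, C.obj M → C.obj ((Family.map G).obj M))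
    (hh : ∀ {M N : ModelFamily B T} (f : M ⟶ N), C.obj M → C.obj N → C.hom f →
      C.hom ((Family.map G).map f)) :
    ConstrainedFamily C T ⥤ ConstrainedFamily C S where
  obj M := ⟨(Family.map G).obj M.family, ho _ M.property⟩
  map {M N} f := ⟨(Family.map G).map f.hom, hh _ M.property N.property f.property⟩
  map_id M := ConstrainedHom.ext ((Family.map G).map_id M.family)
  map_comp f g := ConstrainedHom.ext ((Family.map G).map_comp f.hom g.hom)

/-- The reduct of constrained families along a signature morphism. -/
def ConstrainedFamily.reduct (C : ConstraintSubfunctor B) {S T : B.Sign} (φ : S ⟶ T) :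
    ConstrainedFamily C T ⥤ ConstrainedFamily C S :=
  ConstrainedFamily.map C (B.Mod.map φ.op).toFunctor (C.reduct_obj φ) (C.reduct_hom φ)

theorem ConstrainedFamily.map_eq_id (C : ConstraintSubfunctor B) {S : B.Sign}
    (G : B.Mod.obj (op S) ⥤ B.Mod.obj (op S)) (hG : G = 𝟭 _)
    (ho : ∀ M : ModelFamily B S, C.obj M → C.obj ((Family.map G).obj M))
    (hh : ∀ {M N : ModelFamily B S} (f : M ⟶ N), C.obj M → C.obj N → C.hom f →
      C.hom ((Family.map G).map f)) :
    ConstrainedFamily.map C G ho hh = 𝟭 _ := by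
  subst hG
  rfl

theorem ConstrainedFamily.map_eq_comp (C : ConstraintSubfunctor B) {S T U : B.Sign}
    (G : B.Mod.obj (op U) ⥤ B.Mod.obj (op S)) (G₁ : B.Mod.obj (op U) ⥤ B.Mod.obj (op T))
    (G₂ : B.Mod.obj (op T) ⥤ B.Mod.obj (op S)) (hG : G = G₁ ⋙ G₂)
    (ho : ∀ M : ModelFamily B U, C.obj M → C.obj ((Family.map G).obj M))
    (hh : ∀ {M N : ModelFamily B U} (f : M ⟶ N), C.obj M → C.obj N → C.hom f →
      C.hom ((Family.map G).map f))
    (ho₁ : ∀ M : ModelFamily B U, C.obj M → C.obj ((Family.map G₁).obj M))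
    (hh₁ : ∀ {M N : ModelFamily B U} (f : M ⟶ N), C.obj M → C.obj N → C.hom f →
      C.hom ((Family.map G₁).map f))
    (ho₂ : ∀ M : ModelFamily B T, C.obj M → C.obj ((Family.map G₂).obj M))
    (hh₂ : ∀ {M N : ModelFamily B T} (f : M ⟶ N), C.obj M → C.obj N → C.hom f →
      C.hom ((Family.map G₂).map f)) :
    ConstrainedFamily.map C G ho hh =
      ConstrainedFamily.map C G₁ ho₁ hh₁ ⋙ ConstrainedFamily.map C G₂ ho₂ hh₂ := by
  subst hG
  rfl

/-- The model functor of the constrained families. -/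
def ConstrainedFamily.modFunctor (C : ConstraintSubfunctor B) : B.Signᵒᵖ ⥤ Cat.{u, u + 1} where
  obj S := Cat.of (ConstrainedFamily C S.unop)
  map φ := (ConstrainedFamily.reduct C φ.unop).toCatHom
  map_id S := Cat.ext (ConstrainedFamily.map_eq_id C _
    (congrArg Cat.Hom.toFunctor (B.Mod.map_id S)) (C.reduct_obj _) (C.reduct_hom _))
  map_comp φ ψ := Cat.ext (ConstrainedFamily.map_eq_comp C _ _ _
    (congrArg Cat.Hom.toFunctor (B.Mod.map_comp φ ψ)) (C.reduct_obj (φ ≫ ψ).unop)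
    (C.reduct_hom (φ ≫ ψ).unop) (C.reduct_obj φ.unop) (C.reduct_hom φ.unop)
    (C.reduct_obj ψ.unop) (C.reduct_hom ψ.unop))

/-- The underlying set of worlds of a constrained family. -/
def ConstrainedFamily.worlds (C : ConstraintSubfunctor B) (S : B.Sign) :
    ConstrainedFamily C S ⥤ Type u where
  obj M := M.family.World
  map f := TypeCat.ofHom (FamilyHom.onWorld (ConstrainedHom.hom f))

/-- The stratified institution of the families of models of `B` which satisfy the constraint `C`.
It has the signatures and the sentences of `B`; the states of a family are its worlds, and a
sentence holds at a world if the model at this world satisfies it. -/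
def constrainedTilde (B : Institution.{u}) (C : ConstraintSubfunctor B) :
    StratifiedInstitution.{u} where
  Sign := B.Sign
  Sen := B.Sen
  Mod := ConstrainedFamily.modFunctor C
  strat S := ConstrainedFamily.worlds C S
  stratMap {_ T} _ := 𝟙 (ConstrainedFamily.worlds C T)
  stratMap_id _ _ _ := HEq.rfl
  stratMap_comp _ _ _ _ := HEq.rfl
  Sat S M w ρ := B.Sat S (Family.model (ConstrainedFamily.family M) w) ρ
  sat_condition φ M w ρ := (B.sat_condition φ (Family.model (ConstrainedFamily.family M) w) ρ).symm

/-- The morphisms `m₀ : I ⟶ I₀` and `m : I ⟶ B̃ᶜ` form a decomposition of the stratified institution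
`I`: for each signature the model category of `I` is the pullback of those of the two components
over the category of sets. (Strict morphisms from `I` to the families of models of `B` are the
same as institution morphisms to `B` from the institution of pairs of a model of `I` and one of
its states.) -/
def IsDecomposition {I I₀ : StratifiedInstitution.{u}} {B : Institution.{u}}
    {C : ConstraintSubfunctor B} (m₀ : StrictMorphism I I₀)
    (m : StrictMorphism I (constrainedTilde B C)) : Prop :=
  ∀ S : I.Sign, IsPullback (m₀.β.app (op S)) (m.β.app (op S))
    (I₀.strat (m₀.Φ.obj S)).toCatHom ((constrainedTilde B C).strat (m.Φ.obj S)).toCatHom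

end Families

/-! ### First-order logic, single-sorted and without equality -/

section FOL

open FirstOrder FirstOrder.Language

/-- First-order signatures: for each arity a set of function symbols (first component) and a set of
predicate symbols (second component). The morphisms are those of the product category. -/
abbrev FOLSig : Type (u + 1) := (ℕ → Type u) × (ℕ → Type u)

/-- The first-order language with the symbols of a signature. -/
abbrev folLang (S : FOLSig.{u}) : FirstOrder.Language.{u, u} := ⟨S.1, S.2⟩

/-- The translation of symbols along a signature morphism. -/
abbrev folLHom {S T : FOLSig.{u}} (φ : S ⟶ T) : folLang S →ᴸ folLang T :=
  ⟨fun n f => (φ.1 n) f, fun n p => (φ.2 n) p⟩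

structure FOLModel (S : FOLSig.{u}) where
  carrier : Type u
  [str : (folLang S).Structure carrier]

attribute [instance] FOLModel.str

instance (S : FOLSig.{u}) : Category.{u} (FOLModel S) where
  Hom M N := M.carrier →[folLang S] N.carrier
  id M := Hom.id (folLang S) M.carrier
  comp f g := g.comp f

/-- The reduct functor along a signature morphism: the carrier stays, and a symbol is interpreted as
its translation. -/
def FOLModel.reduct {S T : FOLSig.{u}} (φ : S ⟶ T) : FOLModel T ⥤ FOLModel S where
  obj M := @FOLModel.mk S M.carrier ((folLHom φ).reduct M.carrier)
  map {M N} h :=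
    letI := (folLHom φ).reduct M.carrier
    letI := (folLHom φ).reduct N.carrier
    { toFun := Hom.toFun h
      map_fun' := fun f x => Hom.map_fun' h (φ.1 _ f) x
      map_rel' := fun r x => Hom.map_rel' h (φ.2 _ r) x }

/-- First-order formulas with free variables among `n` variables: atoms, conjunction, negation, and
existential quantification, which binds the last variable. -/
inductive FOLFormula (S : FOLSig.{u}) : ℕ → Type u
  | atom {n k : ℕ} (π : S.2 k) (ts : Fin k → (folLang S).Term (Fin n)) : FOLFormula S n
  | and {n : ℕ} (ρ₁ ρ₂ : FOLFormula S n) : FOLFormula S n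
  | neg {n : ℕ} (ρ : FOLFormula S n) : FOLFormula S n
  | ex {n : ℕ} (ρ : FOLFormula S (n + 1)) : FOLFormula S n

namespace FOLFormula

/-- The translation of formulas along a signature morphism. -/
def map {S T : FOLSig.{u}} (φ : S ⟶ T) : {n : ℕ} → FOLFormula S n → FOLFormula T n
  | _, atom π ts => atom (φ.2 _ π) (fun i => (folLHom φ).onTerm (ts i))
  | _, and ρ₁ ρ₂ => and (map φ ρ₁) (map φ ρ₂)
  | _, neg ρ => neg (map φ ρ)
  | _, ex ρ => ex (map φ ρ)

/-- The Tarskian satisfaction of a formula in a model under a valuation of its variables. -/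
def Sat {S : FOLSig.{u}} (M : FOLModel S) : {n : ℕ} → (Fin n → M.carrier) → FOLFormula S n → Prop
  | _, v, atom π ts => Structure.RelMap (L := folLang S) π (fun i => (ts i).realize v)
  | _, v, and ρ₁ ρ₂ => Sat M v ρ₁ ∧ Sat M v ρ₂
  | _, v, neg ρ => ¬ Sat M v ρ
  | _, v, ex ρ => ∃ a : M.carrier, Sat M (Fin.snoc (α := fun _ => M.carrier) v a) ρ

theorem map_id {S : FOLSig.{u}} {n : ℕ} (ρ : FOLFormula S n) : map (𝟙 S) ρ = ρ := by
  induction ρ with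
  | atom π ts =>
    simp only [map]
    congr 1
    funext i
    exact congrFun (LHom.id_onTerm (L := folLang S)) (ts i)
  | and _ _ h₁ h₂ => simp only [map, h₁, h₂]
  | neg _ h => simp only [map, h]
  | ex _ h => simp only [map, h]

theorem map_comp {S T U : FOLSig.{u}} (φ : S ⟶ T) (ψ : T ⟶ U) {n : ℕ} (ρ : FOLFormula S n) :
    map (φ ≫ ψ) ρ = map ψ (map φ ρ) := by
  induction ρ with
  | atom π ts =>
    simp only [map]
    congr 1
    funext i
    exact congrFun (LHom.comp_onTerm (folLHom ψ) (folLHom φ)) (ts i)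
  | and _ _ h₁ h₂ => simp only [map, h₁, h₂]
  | neg _ h => simp only [map, h]
  | ex _ h => simp only [map, h]

end FOLFormula

theorem realize_onTerm_reduct {S T : FOLSig.{u}} (φ : S ⟶ T) (M : FOLModel T) {α : Type*}
    (v : α → M.carrier) (t : (folLang S).Term α) :
    ((folLHom φ).onTerm t).realize v =
      Term.realize (M := ((FOLModel.reduct φ).obj M).carrier) v t := by
  induction t with
  | var => rfl
  | func f ts ih =>
    simp only [LHom.onTerm, Term.realize, ih]
    rfl

theorem FOLFormula.sat_map {S T : FOLSig.{u}} (φ : S ⟶ T) (M : FOLModel T) {n : ℕ}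
    (v : Fin n → M.carrier) (ρ : FOLFormula S n) :
    Sat M v (map φ ρ) ↔ Sat ((FOLModel.reduct φ).obj M) v ρ := by
  induction ρ with
  | atom π ts =>
    simp only [map, Sat, realize_onTerm_reduct]
    rfl
  | and _ _ h₁ h₂ => simp only [map, Sat, h₁, h₂]
  | neg _ h => simp only [map, Sat, h]
  | ex _ h =>
    simp only [map, Sat, h]
    rfl

/-- First-order logic. The sentences are the formulas without free variables. -/
def FOL : Institution.{u} where
  Sign := FOLSig.{u}
  Sen :=
    { obj := fun S => FOLFormula S 0
      map := fun φ => TypeCat.ofHom (FOLFormula.map φ)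
      map_id := fun S => by ext ρ; exact FOLFormula.map_id ρ
      map_comp := fun φ ψ => by ext ρ; exact FOLFormula.map_comp φ ψ ρ }
  Mod :=
    { obj := fun S => Cat.of (FOLModel S.unop)
      map := fun φ => (FOLModel.reduct φ.unop).toCatHom
      map_id := fun S => rfl
      map_comp := fun φ ψ => rfl }
  Sat S M ρ := FOLFormula.Sat (S := S) M Fin.elim0 ρ
  sat_condition {S T} φ M ρ := by
    have h := FOLFormula.sat_map (S := S) (T := T) φ M Fin.elim0 ρ
    exact h

end FOL

/-! ### Relational logic, the fragment of first-order logic without function symbols -/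

section REL

open FirstOrder FirstOrder.Language

/-- Relational signatures: for each arity a set of predicate symbols. -/
abbrev RELSig : Type (u + 1) := ℕ → Type u

/-- A relational signature as a first-order signature without function symbols. -/
def relToFOL : RELSig.{u} ⥤ FOLSig.{u} where
  obj L := (fun _ => PEmpty, L)
  map φ := (𝟙 _, φ)

/-- The underlying set of a first-order model. -/
def FOLModel.underlying (S : FOLSig.{u}) : FOLModel S ⥤ Type u where
  obj M := M.carrier
  map h := TypeCat.ofHom (Hom.toFun h)

/-- Relational logic as a stratified institution without sentences. The states of a model are its
elements. -/
def REL : StratifiedInstitution.{u} where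
  Sign := RELSig.{u}
  Sen := (Functor.const _).obj PEmpty
  Mod := relToFOL.op ⋙ FOL.Mod
  strat L := FOLModel.underlying (relToFOL.obj L)
  stratMap {_ L'} _ := 𝟙 (FOLModel.underlying (relToFOL.obj L'))
  stratMap_id _ _ _ := HEq.rfl
  stratMap_comp _ _ _ _ := HEq.rfl
  Sat _ _ _ ρ := PEmpty.elim ρ
  sat_condition _ _ _ ρ := PEmpty.elim ρ

end REL

/-! ### Multi-modal first-order modal logic -/

section MMFOL

open FirstOrder FirstOrder.Language

/-- The interpretation of a constant in a first-order model. -/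
abbrev FOLModel.const {S : FOLSig.{u}} (M : FOLModel S) (c : S.1 0) : M.carrier :=
  Structure.funMap (L := folLang S) c Fin.elim0

/-- The sharing condition on a family of first-order models: the models have the same carrier and
the same interpretations of the constants. -/
def IsShared {S : FOLSig.{u}} {W : Type u} (M : W → FOLModel S) : Prop :=
  ∀ w v, (M w).carrier = (M v).carrier ∧ ∀ c : S.1 0, HEq ((M w).const c) ((M v).const c)

/-- The sharing condition on a family of homomorphisms between families of first-order models:
they are the same function on the shared carrier. -/
def IsSharedHom {S : FOLSig.{u}} {W V : Type u} {M : W → FOLModel S} {N : V → FOLModel S}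
    (h₀ : W → V) (h : ∀ w, M w ⟶ N (h₀ w)) : Prop :=
  ∀ w v (x : (M w).carrier) (y : (M v).carrier), HEq x y →
    HEq (Hom.toFun (h w) x) (Hom.toFun (h v) y)

/-- The signatures: a relational signature of modalities, and a first-order signature. -/
abbrev MMFOLSig : Type (u + 1) := RELSig.{u} × FOLSig.{u}

/-- Kripke models: a frame, that is a set of worlds with an interpretation of the modality symbols
as relations, and a family of first-order models with the same carrier and constants, one for
each world. -/
structure KripkeModel (S : MMFOLSig.{u}) where
  frame : FOLModel (relToFOL.obj S.1)
  model : frame.carrier → FOLModel S.2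
  shared : IsShared model

/-- A homomorphism of frames, with a homomorphism of first-order models for each world, all of them
being the same function. -/
@[ext]
structure KripkeHom {S : MMFOLSig.{u}} (M N : KripkeModel S) where
  onFrame : M.frame ⟶ N.frame
  hom : ∀ w, M.model w ⟶ N.model (Hom.toFun onFrame w)
  shared : IsSharedHom (Hom.toFun onFrame) hom

instance (S : MMFOLSig.{u}) : Category.{u} (KripkeModel S) where
  Hom M N := KripkeHom M N
  id M := ⟨𝟙 M.frame, fun w => 𝟙 (M.model w), fun _ _ _ _ h => h⟩
  comp f g := ⟨f.onFrame ≫ g.onFrame, fun w => f.hom w ≫ g.hom (Hom.toFun f.onFrame w),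
    fun w v x y h => g.shared _ _ _ _ (f.shared w v x y h)⟩

/-- The reduct functor along a signature morphism. -/
def KripkeModel.reduct {S T : MMFOLSig.{u}} (φ : S ⟶ T) : KripkeModel T ⥤ KripkeModel S where
  obj M :=
    { frame := (FOLModel.reduct (relToFOL.map φ.1)).obj M.frame
      model := fun w => (FOLModel.reduct φ.2).obj (M.model w)
      shared := fun w v => ⟨(M.shared w v).1, fun c => (M.shared w v).2 (φ.2.1 0 c)⟩ }
  map f :=
    { onFrame := (FOLModel.reduct (relToFOL.map φ.1)).map f.onFrame
      hom := fun w => (FOLModel.reduct φ.2).map (f.hom w)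
      shared := f.shared }

/-- Formulas with free variables among `n` variables: those of first-order logic, and
`⟨l⟩(ρ₁, …, ρₖ)` for each modality symbol `l` of arity `k + 1`. -/
inductive MMFOLFormula (S : MMFOLSig.{u}) : ℕ → Type u
  | atom {n k : ℕ} (π : S.2.2 k) (ts : Fin k → (folLang S.2).Term (Fin n)) : MMFOLFormula S n
  | and {n : ℕ} (ρ₁ ρ₂ : MMFOLFormula S n) : MMFOLFormula S n
  | neg {n : ℕ} (ρ : MMFOLFormula S n) : MMFOLFormula S n
  | ex {n : ℕ} (ρ : MMFOLFormula S (n + 1)) : MMFOLFormula S n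
  | dia {n k : ℕ} (l : S.1 (k + 1)) (ρs : Fin k → MMFOLFormula S n) : MMFOLFormula S n

namespace MMFOLFormula

/-- The translation of formulas along a signature morphism. -/
def map {S T : MMFOLSig.{u}} (φ : S ⟶ T) : {n : ℕ} → MMFOLFormula S n → MMFOLFormula T n
  | _, atom π ts => atom (φ.2.2 _ π) (fun i => (folLHom φ.2).onTerm (ts i))
  | _, and ρ₁ ρ₂ => and (map φ ρ₁) (map φ ρ₂)
  | _, neg ρ => neg (map φ ρ)
  | _, ex ρ => ex (map φ ρ)
  | _, dia l ρs => dia (φ.1 _ l) (fun i => map φ (ρs i))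

/-- First-order formulas are formulas. -/
def ofFOL {S : MMFOLSig.{u}} : {n : ℕ} → FOLFormula S.2 n → MMFOLFormula S n
  | _, .atom π ts => atom π ts
  | _, .and ρ₁ ρ₂ => and (ofFOL ρ₁) (ofFOL ρ₂)
  | _, .neg ρ => neg (ofFOL ρ)
  | _, .ex ρ => ex (ofFOL ρ)

/-- The satisfaction of a formula in a Kripke model at a world, under a valuation of its variables
in the shared carrier; when the world changes, the valuation is transported along the equality
of the carriers. -/
def Sat {S : MMFOLSig.{u}} (M : KripkeModel S) : {n : ℕ} → (w : M.frame.carrier) →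
    (Fin n → (M.model w).carrier) → MMFOLFormula S n → Prop
  | _, w, x, atom π ts =>
    Structure.RelMap (L := folLang S.2) (M := (M.model w).carrier) π
      (fun i => (ts i).realize x)
  | _, w, x, and ρ₁ ρ₂ => Sat M w x ρ₁ ∧ Sat M w x ρ₂
  | _, w, x, neg ρ => ¬ Sat M w x ρ
  | _, w, x, ex ρ =>
    ∃ a : (M.model w).carrier, Sat M w (Fin.snoc (α := fun _ => (M.model w).carrier) x a) ρ
  | _, w, x, dia (k := k) l ρs =>
    ∃ v : Fin k → M.frame.carrier,
      Structure.RelMap (L := folLang (relToFOL.obj S.1)) (M := M.frame.carrier) l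
        (Fin.cons (α := fun _ => M.frame.carrier) w v) ∧
      ∀ i, Sat M (v i) (fun j => cast (M.shared w (v i)).1 (x j)) (ρs i)

theorem map_id {S : MMFOLSig.{u}} {n : ℕ} (ρ : MMFOLFormula S n) : map (𝟙 S) ρ = ρ := by
  induction ρ with
  | atom π ts =>
    simp only [map]
    congr 1
    funext i
    exact congrFun (LHom.id_onTerm (L := folLang S.2)) (ts i)
  | and _ _ h₁ h₂ => simp only [map, h₁, h₂]
  | neg _ h => simp only [map, h]
  | ex _ h => simp only [map, h]
  | dia _ _ h =>
    simp only [map, h]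
    rfl

theorem map_comp {S T U : MMFOLSig.{u}} (φ : S ⟶ T) (ψ : T ⟶ U) {n : ℕ}
    (ρ : MMFOLFormula S n) : map (φ ≫ ψ) ρ = map ψ (map φ ρ) := by
  induction ρ with
  | atom π ts =>
    simp only [map]
    congr 1
    funext i
    exact congrFun (LHom.comp_onTerm (folLHom ψ.2) (folLHom φ.2)) (ts i)
  | and _ _ h₁ h₂ => simp only [map, h₁, h₂]
  | neg _ h => simp only [map, h]
  | ex _ h => simp only [map, h]
  | dia _ _ h =>
    simp only [map, h]
    rfl

theorem map_ofFOL {S T : MMFOLSig.{u}} (φ : S ⟶ T) {n : ℕ} (ρ : FOLFormula S.2 n) :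
    map φ (ofFOL ρ) = ofFOL (FOLFormula.map φ.2 ρ) := by
  induction ρ with
  | atom π ts => rfl
  | and _ _ h₁ h₂ => simp only [map, ofFOL, FOLFormula.map, h₁, h₂]
  | neg _ h => simp only [map, ofFOL, FOLFormula.map, h]
  | ex _ h => simp only [map, ofFOL, FOLFormula.map, h]

theorem sat_map {S T : MMFOLSig.{u}} (φ : S ⟶ T) (M : KripkeModel T) {n : ℕ}
    (w : M.frame.carrier) (x : Fin n → (M.model w).carrier) (ρ : MMFOLFormula S n) :
    Sat M w x (map φ ρ) ↔ Sat ((KripkeModel.reduct φ).obj M) w x ρ := by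
  induction ρ generalizing w with
  | atom π ts =>
    simp only [map, Sat, realize_onTerm_reduct]
    rfl
  | and _ _ h₁ h₂ => simp only [map, Sat, h₁, h₂]
  | neg _ h => simp only [map, Sat, h]
  | ex _ h =>
    simp only [map, Sat, h]
    rfl
  | dia _ _ h =>
    simp only [map, Sat, h]
    rfl

theorem sat_ofFOL {S : MMFOLSig.{u}} (M : KripkeModel S) {n : ℕ}
    (w : M.frame.carrier) (x : Fin n → (M.model w).carrier) (ρ : FOLFormula S.2 n) :
    Sat M w x (ofFOL ρ) ↔ FOLFormula.Sat (M.model w) x ρ := by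
  induction ρ with
  | atom π ts => rfl
  | and _ _ h₁ h₂ => simp only [ofFOL, Sat, FOLFormula.Sat, h₁, h₂]
  | neg _ h => simp only [ofFOL, Sat, FOLFormula.Sat, h]
  | ex _ h => simp only [ofFOL, Sat, FOLFormula.Sat, h]

end MMFOLFormula

/-- The underlying set of worlds of a Kripke model. -/
def KripkeModel.worlds (S : MMFOLSig.{u}) : KripkeModel S ⥤ Type u where
  obj M := M.frame.carrier
  map h := TypeCat.ofHom (Hom.toFun (KripkeHom.onFrame h))

/-- Multi-modal first-order modal logic as a stratified institution. The sentences are the formulas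
without free variables, and the states of a Kripke model are its worlds. -/
def MMFOL : StratifiedInstitution.{u} where
  Sign := MMFOLSig.{u}
  Sen :=
    { obj := fun S => MMFOLFormula S 0
      map := fun φ => TypeCat.ofHom (MMFOLFormula.map φ)
      map_id := fun S => by ext ρ; exact MMFOLFormula.map_id ρ
      map_comp := fun φ ψ => by ext ρ; exact MMFOLFormula.map_comp φ ψ ρ }
  Mod :=
    { obj := fun S => Cat.of (KripkeModel S.unop)
      map := fun φ => (KripkeModel.reduct φ.unop).toCatHom
      map_id := fun S => rfl
      map_comp := fun φ ψ => rfl }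
  strat S := KripkeModel.worlds S
  stratMap {_ T} _ := 𝟙 (KripkeModel.worlds T)
  stratMap_id _ _ _ := HEq.rfl
  stratMap_comp _ _ _ _ := HEq.rfl
  Sat S M w ρ := MMFOLFormula.Sat (S := S) M w Fin.elim0 ρ
  sat_condition {S T} φ M w ρ := by
    have h := MMFOLFormula.sat_map (S := S) (T := T) φ M w Fin.elim0 ρ
    exact h.symm

/-! ### The decomposition of multi-modal first-order modal logic -/

/-- The constraint on families of first-order models given by the sharing of the carriers and of
the interpretations of the constants. -/
def sharing : ConstraintSubfunctor FOL.{u} where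
  obj {S} M := IsShared (S := S) M.model
  hom {S M N} h := IsSharedHom (S := S) (M := M.model) (N := N.model) h.onWorld h.hom
  id_mem _ _ := fun _ _ _ _ h => h
  comp_mem _ _ _ _ _ hf hg := fun w v x y h => hg _ _ _ _ (hf w v x y h)
  reduct_obj φ _ h := fun w v => ⟨(h w v).1, fun c => (h w v).2 (φ.1 0 c)⟩
  reduct_hom _ _ _ _ _ _ h := h

/-- The frame of a Kripke model. -/
def KripkeModel.frames (S : MMFOL.{u}.Sign) :
    MMFOL.{u}.Mod.obj (op S) ⥤ REL.{u}.Mod.obj (op (Prod.fst S)) where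
  obj M := KripkeModel.frame M
  map h := KripkeHom.onFrame h

/-- The family of first-order models of a Kripke model. -/
def KripkeModel.families (S : MMFOL.{u}.Sign) : MMFOL.{u}.Mod.obj (op S) ⥤
    (constrainedTilde FOL.{u} sharing.{u}).Mod.obj (op (Prod.snd S)) where
  obj M := ⟨⟨(KripkeModel.frame M).carrier, KripkeModel.model M⟩, KripkeModel.shared M⟩
  map h := ⟨⟨Hom.toFun (KripkeHom.onFrame h), KripkeHom.hom h⟩, KripkeHom.shared h⟩

/-- The projection which keeps the modality symbols and the frames. -/
def mmfolToREL : StrictMorphism MMFOL.{u} REL.{u} where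
  Φ := CategoryTheory.Prod.fst _ _
  α := { app := fun S => TypeCat.ofHom PEmpty.elim
         naturality := fun S T φ => by ext ρ; exact PEmpty.elim ρ }
  β :=
    { app := fun S => (KripkeModel.frames S.unop).toCatHom
      naturality := fun S T φ => rfl }
  strat_eq S := rfl
  stratMap_eq φ M v w h := h
  sat_condition _ _ _ _ ρ := PEmpty.elim ρ

/-- The projection which keeps the first-order symbols and the families of first-order models. -/
def mmfolToFOL : StrictMorphism MMFOL.{u} (constrainedTilde FOL.{u} sharing.{u}) where
  Φ := CategoryTheory.Prod.snd _ _
  α := { app := fun S => TypeCat.ofHom (MMFOLFormula.ofFOL (S := S))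
         naturality := fun S T φ => by
           ext ρ
           exact (MMFOLFormula.map_ofFOL φ ρ).symm }
  β :=
    { app := fun S => (KripkeModel.families S.unop).toCatHom
      naturality := fun S T φ => rfl }
  strat_eq S := rfl
  stratMap_eq φ M v w h := h
  sat_condition S M v w ρ h := by
    obtain rfl : v = w := eq_of_heq h
    exact MMFOLFormula.sat_ofFOL (S := S) M v Fin.elim0 ρ

end MMFOL

end StratInst

/-! Both claims rest on how little data a Kripke model has.

Decomposition. A Kripke model is a frame together with a family of first-order models satisfying the
sharing condition, the two having the same set of worlds; a homomorphism is likewise a pair with the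
same map on worlds. This is the explicit description of a strict pullback of categories, so only an
elementwise criterion for pullbacks in `Cat` is needed (`isPullback_toCatHom`): compatible pairs of
objects, and of morphisms, lift uniquely.

Semi-exactness. Pushouts of signatures are never computed. Fix a set `W` of worlds and a family `A`
of equal carriers. All possible interpretations of symbols over `W` and `A` form a signature
`interpretationSig W A`, and a model over `W` and `A` is the same as a signature morphism into it.
Reduct becomes precomposition (`KripkeModel.reduct_ofInterpretation`), so the model functor is
locally representable. Since reducts keep worlds and carriers, two models with a common reduct live
over the same `W` and `A`; they form a cocone, and amalgamation is exactly the universal property of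
the pushout. Indexing `A` by `W`, rather than taking one carrier set, keeps the correspondence exact
when there are no worlds. -/

namespace StratInst

/-! ### Strict pullbacks of categories -/

section CatPullback

universe v w

variable {P A B D : Type w} [Category.{v} P] [Category.{v} A] [Category.{v} B] [Category.{v} D]

/-- Two functors into `P` with the same composites with `F` and `G` are equal, if objects and
morphisms of `P` are determined by their images under `F` and `G`. -/
theorem functor_eq_of_comp_eq {X : Type w} [Category.{v} X] {F : P ⥤ A} {G : P ⥤ B}
    (hobj : ∀ p q : P, F.obj p = F.obj q → G.obj p = G.obj q → p = q)
    (hhom : ∀ (p q : P) (h k : p ⟶ q), F.map h = F.map k → G.map h = G.map k → h = k)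
    {L L' : X ⥤ P} (hF : L ⋙ F = L' ⋙ F) (hG : L ⋙ G = L' ⋙ G) : L = L' := by
  refine CategoryTheory.Functor.ext (fun x => hobj _ _ (Functor.congr_obj hF x) (Functor.congr_obj hG x))
    fun x y f => hhom _ _ _ _ ?_ ?_
  -- A functor sends `eqToHom` to `eqToHom`, so the image of the conjugated morphism is the
  -- conjugate of its image.
  · simpa [eqToHom_map] using Functor.congr_hom hF f
  · simpa [eqToHom_map] using Functor.congr_hom hG f

/-- Chosen lifts of objects match the given ones only up to propositional equality; this removes the
resulting transports. -/
theorem heq_eqToHom_comp_comp_eqToHom {x y x' y' : A} (hx : x' = x) (f : x ⟶ y) (hy : y = y') :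
    HEq (eqToHom hx ≫ f ≫ eqToHom hy) f := by
  subst hx hy
  simp

theorem functor_map_heq (H : A ⥤ D) {x y x' y' : A} (hx : x = x') (hy : y = y') {f : x ⟶ y}
    {g : x' ⟶ y'} (h : HEq f g) : HEq (H.map f) (H.map g) := by
  subst hx hy
  cases h
  rfl

/-- A pair of functors which agree in `D` factors through `P`, if compatible pairs of objects and
of morphisms lift to `P`, the latter uniquely. -/
theorem exists_lift_of_lifts {X : Type w} [Category.{v} X] {F : P ⥤ A} {G : P ⥤ B}
    {H : A ⥤ D} {K : B ⥤ D}
    (hobj : ∀ a b, H.obj a = K.obj b → ∃ p, F.obj p = a ∧ G.obj p = b)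
    (hhom : ∀ (p q : P) (a : F.obj p ⟶ F.obj q) (b : G.obj p ⟶ G.obj q),
      HEq (H.map a) (K.map b) → ∃ h : p ⟶ q, F.map h = a ∧ G.map h = b)
    (hext : ∀ (p q : P) (h k : p ⟶ q), F.map h = F.map k → G.map h = G.map k → h = k)
    (F' : X ⥤ A) (G' : X ⥤ B) (comm : F' ⋙ H = G' ⋙ K) :
    ∃ L : X ⥤ P, L ⋙ F = F' ∧ L ⋙ G = G' := by
  choose p hpF hpG using fun x => hobj (F'.obj x) (G'.obj x) (Functor.congr_obj comm x)
  have key : ∀ {x y : X} (f : x ⟶ y), ∃ h : p x ⟶ p y,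
      F.map h = eqToHom (hpF x) ≫ F'.map f ≫ eqToHom (hpF y).symm ∧
      G.map h = eqToHom (hpG x) ≫ G'.map f ≫ eqToHom (hpG y).symm := by
    intro x y f
    refine hhom _ _ _ _ ?_
    have h₁ := functor_map_heq H (hpF x) (hpF y)
      (heq_eqToHom_comp_comp_eqToHom (hpF x) (F'.map f) (hpF y).symm)
    have h₂ := functor_map_heq K (hpG x) (hpG y)
      (heq_eqToHom_comp_comp_eqToHom (hpG x) (G'.map f) (hpG y).symm)
    -- Compatibility in `D` is given for the original morphisms; `h₁` and `h₂` carry it over to the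
    -- transported ones.
    have h₃ : HEq (H.map (F'.map f)) (K.map (G'.map f)) := Functor.hcongr_hom comm f
    exact h₁.trans (h₃.trans h₂.symm)
  choose m hmF hmG using @key
  let L : X ⥤ P :=
    { obj := p
      map := m
      -- The lifts of morphisms are arbitrary choices, but `hext` makes them unique, so
      -- functoriality may be checked in `A` and `B`, where the inner transports cancel.
      map_id := fun x => hext _ _ _ _ (by simp [hmF]) (by simp [hmG])
      map_comp := fun f g => hext _ _ _ _ (by simp [hmF]) (by simp [hmG]) }
  exact ⟨L, CategoryTheory.Functor.ext hpF fun x y f => hmF f,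
    CategoryTheory.Functor.ext hpG fun x y f => hmG f⟩

/-- A commutative square of functors is a pullback square if compatible pairs of objects and of
morphisms lift uniquely. -/
theorem isPullback_toCatHom {F : P ⥤ A} {G : P ⥤ B} {H : A ⥤ D} {K : B ⥤ D}
    (comm : F ⋙ H = G ⋙ K)
    (hobj : ∀ a b, H.obj a = K.obj b → ∃ p, F.obj p = a ∧ G.obj p = b)
    (hobj_ext : ∀ p q : P, F.obj p = F.obj q → G.obj p = G.obj q → p = q)
    (hhom : ∀ (p q : P) (a : F.obj p ⟶ F.obj q) (b : G.obj p ⟶ G.obj q),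
      HEq (H.map a) (K.map b) → ∃ h : p ⟶ q, F.map h = a ∧ G.map h = b)
    (hhom_ext : ∀ (p q : P) (h k : p ⟶ q), F.map h = F.map k → G.map h = G.map k → h = k) :
    IsPullback F.toCatHom G.toCatHom H.toCatHom K.toCatHom := by
  refine ⟨⟨Cat.ext comm⟩, ⟨Limits.PullbackCone.IsLimit.mk _
    (fun s => (exists_lift_of_lifts hobj hhom hhom_ext s.fst.toFunctor s.snd.toFunctor
      (congrArg Cat.Hom.toFunctor s.condition)).choose.toCatHom) ?_ ?_ ?_⟩⟩
  · exact fun s => Cat.ext (exists_lift_of_lifts hobj hhom hhom_ext s.fst.toFunctor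
      s.snd.toFunctor (congrArg Cat.Hom.toFunctor s.condition)).choose_spec.1
  · exact fun s => Cat.ext (exists_lift_of_lifts hobj hhom hhom_ext s.fst.toFunctor
      s.snd.toFunctor (congrArg Cat.Hom.toFunctor s.condition)).choose_spec.2
  · intro s m hF hG
    have h := (exists_lift_of_lifts hobj hhom hhom_ext s.fst.toFunctor s.snd.toFunctor
      (congrArg Cat.Hom.toFunctor s.condition)).choose_spec
    exact Cat.ext (functor_eq_of_comp_eq hobj_ext hhom_ext
      ((congrArg Cat.Hom.toFunctor hF).trans h.1.symm)
      ((congrArg Cat.Hom.toFunctor hG).trans h.2.symm))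

end CatPullback

/-! ### The decomposition -/

section Decomposition

open FirstOrder FirstOrder.Language

variable {S : MMFOLSig.{u}}

/-- Once the two sets of worlds are identified, the pair is literally the data of a Kripke model. -/
theorem KripkeModel.exists_of_frame_family (f : FOLModel (relToFOL.obj S.1))
    (g : ConstrainedFamily sharing.{u} (S := S.2)) (h : f.carrier = g.family.World) :
    ∃ M : KripkeModel S, M.frame = f ∧ (KripkeModel.families S).obj M = g := by
  obtain ⟨⟨W, m⟩, hm⟩ := g
  dsimp only at h
  subst h
  exact ⟨⟨f, m, hm⟩, rfl, rfl⟩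

theorem KripkeModel.eq_of_frame_family {M N : KripkeModel S} (h₁ : M.frame = N.frame)
    (h₂ : (KripkeModel.families S).obj M = (KripkeModel.families S).obj N) : M = N := by
  obtain ⟨f, m, hm⟩ := M
  obtain ⟨f', m', hm'⟩ := N
  dsimp only at h₁
  subst h₁
  have h₃ := congrArg ConstrainedFamily.family h₂
  -- With the frames identified, both families are indexed by the same set, so the heterogeneous
  -- equality is an ordinary one.
  obtain rfl : m = m' := eq_of_heq (Family.mk.inj h₃).2
  rfl

theorem KripkeHom.exists_of_frame_family {M N : KripkeModel S} (a : M.frame ⟶ N.frame)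
    (b : (KripkeModel.families S).obj M ⟶ (KripkeModel.families S).obj N)
    (h : FamilyHom.onWorld (ConstrainedHom.hom b) = Hom.toFun a) :
    ∃ k : M ⟶ N, KripkeHom.onFrame k = a ∧ (KripkeModel.families S).map k = b := by
  obtain ⟨⟨w, m⟩, hm⟩ := b
  change w = Hom.toFun a at h
  subst h
  exact ⟨⟨a, m, hm⟩, rfl, rfl⟩

theorem KripkeHom.eq_of_frame_family {M N : KripkeModel S} {h k : M ⟶ N}
    (h₁ : KripkeHom.onFrame h = KripkeHom.onFrame k)
    (h₂ : (KripkeModel.families S).map h = (KripkeModel.families S).map k) : h = k := by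
  obtain ⟨a, m, hm⟩ := h
  obtain ⟨a', m', hm'⟩ := k
  dsimp only at h₁
  subst h₁
  have h₃ := congrArg ConstrainedHom.hom h₂
  obtain rfl : m = m' := eq_of_heq (FamilyHom.mk.inj h₃).2
  rfl

theorem isDecomposition_mmfol : IsDecomposition mmfolToREL.{u} mmfolToFOL.{u} := fun S =>
  isPullback_toCatHom (F := KripkeModel.frames S) (G := KripkeModel.families S) rfl
    (fun a b h => KripkeModel.exists_of_frame_family (S := S) a b h)
    (fun _ _ h₁ h₂ => KripkeModel.eq_of_frame_family (S := S) h₁ h₂)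
    -- The square commutes definitionally, so the two maps of worlds have the same type and their
    -- heterogeneous equality is an equality of functions.
    (fun _ _ a b h => KripkeHom.exists_of_frame_family (S := S) a b
      (congrArg TypeCat.homEquiv (eq_of_heq h).symm))
    (fun _ _ _ _ h₁ h₂ => KripkeHom.eq_of_frame_family (S := S) h₁ h₂)

end Decomposition

/-! ### Kripke models as signature morphisms -/

section SemiExact

open FirstOrder FirstOrder.Language

/-- The signature of all symbols over a set `W` of worlds and a family `A` of carriers: the
modality symbols are the relations on `W`, the function and predicate symbols are the families of
operations and of relations on the carriers, where a nullary operation is the same at all worlds. -/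
def interpretationSig (W : Type u) (A : W → Type u) : MMFOLSig.{u} :=
  (fun n => (Fin n → W) → Prop,
    fun n => {f : ∀ w, (Fin n → A w) → A w // n = 0 → ∀ w v x y, HEq (f w x) (f v y)},
    fun n => ∀ w, (Fin n → A w) → Prop)

variable {S T : MMFOLSig.{u}} {W : Type u} {A : W → Type u}

/-- The Kripke model in which each symbol is interpreted as its image under a morphism to the
signature of all symbols. -/
def KripkeModel.ofInterpretation (hA : ∀ w v, A w = A v) (m : S ⟶ interpretationSig W A) :
    KripkeModel S where
  frame := @FOLModel.mk (relToFOL.obj S.1) W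
    { funMap := fun f _ => PEmpty.elim f
      RelMap := fun {n} l => m.1 n l }
  model w := @FOLModel.mk S.2 (A w)
    { funMap := fun {n} f => (m.2.1 n f).1 w
      RelMap := fun {n} p => m.2.2 n p w }
  shared w v := ⟨hA w v, fun c => (m.2.1 0 c).2 rfl w v _ _⟩

/-- Translating a symbol and then interpreting it is composition of signature morphisms; this
naturality brings the pushout into play. -/
theorem KripkeModel.reduct_ofInterpretation (φ : S ⟶ T) (hA : ∀ w v, A w = A v)
    (m : T ⟶ interpretationSig W A) :
    (KripkeModel.reduct φ).obj (KripkeModel.ofInterpretation hA m) =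
      KripkeModel.ofInterpretation hA (φ ≫ m) := by
  unfold KripkeModel.reduct KripkeModel.ofInterpretation
  congr 1

theorem KripkeModel.exists_ofInterpretation (M : KripkeModel S) :
    ∃ (W : Type u) (A : W → Type u) (hA : ∀ w v, A w = A v) (m : S ⟶ interpretationSig W A),
      KripkeModel.ofInterpretation hA m = M := by
  refine ⟨M.frame.carrier, fun w => (M.model w).carrier, fun w v => (M.shared w v).1,
    (fun n => ↾fun l => Structure.RelMap (L := folLang (relToFOL.obj S.1)) l,
      fun n => ↾fun f => ⟨fun w => Structure.funMap (L := folLang S.2) f, ?_⟩,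
      fun n => ↾fun p w => Structure.RelMap (L := folLang S.2) p), ?_⟩
  -- There is only one empty tuple of arguments, so the condition on nullary operations is the
  -- sharing of constants.
  · rintro rfl w v x y
    obtain rfl := Subsingleton.elim x Fin.elim0
    obtain rfl := Subsingleton.elim y Fin.elim0
    exact (M.shared w v).2 f
  · obtain ⟨⟨W, str⟩, m, hm⟩ := M
    unfold KripkeModel.ofInterpretation
    congr 1
    congr 1
    -- Only the function symbols of the frame need an argument: a relational signature has none.
    refine Structure.ext ?_ rfl
    funext n f
    exact PEmpty.elim f

/-- The worlds, the carriers and the interpretation of every symbol can all be read off the model,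
so the representing morphism is unique. -/
theorem KripkeModel.eq_of_ofInterpretation_eq {W' : Type u} {A' : W' → Type u}
    {hA : ∀ w v, A w = A v} {hA' : ∀ w v, A' w = A' v} {m : S ⟶ interpretationSig W A}
    {m' : S ⟶ interpretationSig W' A'}
    (h : KripkeModel.ofInterpretation hA m = KripkeModel.ofInterpretation hA' m') :
    W = W' ∧ HEq A A' ∧ HEq m m' := by
  obtain rfl : W = W' := congrArg (fun M => M.frame.carrier) h
  obtain ⟨hf, hm⟩ := KripkeModel.mk.inj h
  replace hm := eq_of_heq hm
  obtain rfl : A = A' := funext fun w => congrArg FOLModel.carrier (congrFun hm w)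
  have hf' := eq_of_heq (FOLModel.mk.inj hf).2
  have hm' := fun w => eq_of_heq (FOLModel.mk.inj (congrFun hm w)).2
  refine ⟨rfl, HEq.rfl, heq_of_eq (Prod.ext ?_ (Prod.ext ?_ ?_))⟩
  · funext n
    ext l
    exact congrArg (fun s : (folLang (relToFOL.obj S.1)).Structure W => s.RelMap l) hf'
  · funext n
    ext f
    -- The condition on nullary operations is a proposition, so only the underlying operations are
    -- compared.
    refine Subtype.ext (funext fun w => ?_)
    exact congrArg (fun s : (folLang S.2).Structure (A w) => s.funMap f) (hm' w)
  · funext n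
    ext p
    refine funext fun w => ?_
    exact congrArg (fun s : (folLang S.2).Structure (A w) => s.RelMap p) (hm' w)

/-- Kripke models over a pushout of signatures are amalgamated by the universal property of the
pushout, applied to their interpretations. -/
theorem KripkeModel.existsUnique_amalgamation {S₁ S₂ : MMFOLSig.{u}} {φ₁ : S ⟶ S₁} {φ₂ : S ⟶ S₂}
    {θ₁ : S₁ ⟶ T} {θ₂ : S₂ ⟶ T} (hpo : IsPushout φ₁ φ₂ θ₁ θ₂) (M₁ : KripkeModel S₁)
    (M₂ : KripkeModel S₂)
    (hM : (KripkeModel.reduct φ₁).obj M₁ = (KripkeModel.reduct φ₂).obj M₂) :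
    ∃! M : KripkeModel T,
      (KripkeModel.reduct θ₁).obj M = M₁ ∧ (KripkeModel.reduct θ₂).obj M = M₂ := by
  obtain ⟨W, A, hA, m₁, rfl⟩ := M₁.exists_ofInterpretation
  obtain ⟨W₂, A₂, hA₂, m₂, rfl⟩ := M₂.exists_ofInterpretation
  simp only [KripkeModel.reduct_ofInterpretation] at hM
  -- The common reduct forces equal worlds and carriers; what remains, `hm`, says that `m₁` and `m₂`
  -- form a cocone over `φ₁` and `φ₂`.
  obtain ⟨rfl, hAA, hm⟩ := KripkeModel.eq_of_ofInterpretation_eq hM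
  obtain rfl := eq_of_heq hAA
  refine ⟨KripkeModel.ofInterpretation hA (hpo.desc m₁ m₂ (eq_of_heq hm)), ?_, ?_⟩
  · simp only [KripkeModel.reduct_ofInterpretation, IsPushout.inl_desc, IsPushout.inr_desc,
      and_self]
  · rintro M ⟨h₁, h₂⟩
    obtain ⟨W', A', hA', m, rfl⟩ := M.exists_ofInterpretation
    rw [KripkeModel.reduct_ofInterpretation] at h₁ h₂
    -- The first reduct already fixes the worlds and carriers of the competitor, so it too is a
    -- morphism to `interpretationSig W A`, and the pushout determines it.
    obtain ⟨rfl, hAA, hm₁⟩ := KripkeModel.eq_of_ofInterpretation_eq h₁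
    obtain rfl := eq_of_heq hAA
    obtain ⟨-, -, hm₂⟩ := KripkeModel.eq_of_ofInterpretation_eq h₂
    congr 1
    apply hpo.hom_ext
    · rw [IsPushout.inl_desc, eq_of_heq hm₁]
    · rw [IsPushout.inr_desc, eq_of_heq hm₂]

/-- Multi-modal first-order modal logic is semi-exact. -/
theorem isSemiExact_mmfol : MMFOL.{u}.IsSemiExact :=
  fun {S S₁ S₂ T} _ _ _ _ hpo M₁ M₂ hM =>
    KripkeModel.existsUnique_amalgamation (S := S) (S₁ := S₁) (S₂ := S₂) (T := T) hpo M₁ M₂ hM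

end SemiExact

end StratInst

/-- Multi-modal first-order modal logic, which is decomposed into relational logic and the
constrained families of first-order models with shared carriers and constants, is semi-exact. -/
theorem mainTheorem4 :
    StratInst.IsDecomposition StratInst.mmfolToREL.{u} StratInst.mmfolToFOL.{u} ∧
      StratInst.MMFOL.{u}.IsSemiExact :=
  ⟨StratInst.isDecomposition_mmfol, StratInst.isSemiExact_mmfol⟩
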